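/- Let $p$ be a prime. All groups are additive abelian groups. A basic subgroup of a $p$-group $G$ is a pure subgroup $B$ of $G$ that is a direct sum of cyclic groups and for which $G/B$ is divisible. A subgroup $L$ of a $p$-group $G$ is large if it is fully invariant in $G$ (mapped into itself by every endomorphism of $G$) and $G=L+B$ for every basic subgroup $B$ of $G$. A $p$-group $T$ is torsion-complete if the canonical map $T\to\varprojlim_n T/p^nT$ into its $p$-adic completion is injective with image the torsion subgroup of the completion. A homomorphism is small if its kernel contains a large subgroup of its domain. A $p$-group $G$ is thin if every homomorphism from a torsion-complete $p$-group to $G$ is small. **Theorem 3.** Let $G$ be an abelian $p$-group and let $L$ be any large subgroup of $G$. Then $G$ is thin if and only if $L$ is thin. -/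

import Mathlib

open scoped DirectSum

namespace ThinGroup

universe u

/-- The (additive) abelian group `G` is a `p`-group: every element is killed by a power of `p`. -/
def IsPrimary (p : ℕ) (G : Type u) [AddCommGroup G] : Prop :=
  ∀ g : G, ∃ k : ℕ, p ^ k • g = 0

/-- `A` is a direct sum of cyclic groups. -/
def IsDirectSumOfCyclics (A : Type u) [AddCommGroup A] : Prop :=
  ∃ (ι : Type u) (n : ι → ℕ), Nonempty (A ≃+ ⨁ i, ZMod (n i))

/-- `B` is a pure subgroup of `G`: `B ∩ nG = nB` for every `n`. -/
def IsPureSubgroup {G : Type u} [AddCommGroup G] (B : AddSubgroup G) : Prop :=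
  ∀ (n : ℕ) (g : G), n • g ∈ B → ∃ b ∈ B, n • b = n • g

/-- `D` is a divisible group. -/
def IsDivisible (D : Type u) [AddCommGroup D] : Prop :=
  ∀ n : ℕ, n ≠ 0 → ∀ d : D, ∃ e : D, n • e = d

/-- `B` is a basic subgroup of the abelian `p`-group `G`: it is a direct sum of cyclic groups,
it is pure in `G`, and `G ⧸ B` is divisible. -/
structure IsBasicSubgroup {G : Type u} [AddCommGroup G] (B : AddSubgroup G) : Prop where
  directSum : IsDirectSumOfCyclics B
  pure : IsPureSubgroup B
  divisible : IsDivisible (G ⧸ B)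

/-- `L` is a large subgroup of the abelian `p`-group `G`: it is fully invariant (mapped into
itself by every endomorphism of `G`) and `L + B = G` for every basic subgroup `B` of `G`. -/
structure IsLarge {G : Type u} [AddCommGroup G] (L : AddSubgroup G) : Prop where
  fullyInvariant : (AddSubgroup.toIntSubmodule L).IsFullyInvariant
  sup_basic : ∀ B : AddSubgroup G, IsBasicSubgroup B → L ⊔ B = ⊤

/-- `T` is a torsion-complete `p`-group: the canonical map of `T` into its `p`-adic completion
`lim T / pⁿT` is injective and its image is the torsion part of the completion. -/
structure IsTorsionComplete (p : ℕ) (T : Type u) [AddCommGroup T] : Prop where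
  primary : IsPrimary p T
  injective : Function.Injective (AdicCompletion.of (Ideal.span {(p : ℤ)}) T)
  range_eq : Set.range (AdicCompletion.of (Ideal.span {(p : ℤ)}) T) =
    {x | IsOfFinAddOrder x}

/-- A homomorphism is small if its kernel contains a large subgroup of its domain. -/
def IsSmall {T G : Type u} [AddCommGroup T] [AddCommGroup G] (f : T →+ G) : Prop :=
  ∃ K : AddSubgroup T, IsLarge K ∧ K ≤ f.ker

/-- The abelian `p`-group `G` is thin: every homomorphism from a torsion-complete `p`-group
to `G` is small. -/
def IsThin (p : ℕ) (G : Type u) [AddCommGroup G] : Prop :=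
  ∀ (T : Type u) [AddCommGroup T], IsTorsionComplete p T → ∀ f : T →+ G, IsSmall f

end ThinGroup

namespace ThinGroup

universe u

/-! ### Bases adapted to the height filtration, and the basic subgroups they generate. -/

section Primary

variable {p : ℕ} {G : Type u} [AddCommGroup G]

/-! Thinness passes to every subgroup, since composing with the inclusion does not change kernels.
The converse rests on Pierce's condition `ContainsHighTorsion`: a large subgroup satisfies it
(`IsLarge.containsHighTorsion`), and a map whose kernel satisfies it is small
(`isSmall_of_containsHighTorsion_ker`).

Suppose `f : T → G` violates the condition at some `k`, with witnesses `y` of arbitrarily high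
exponent. Since `L` contains the `p ^ j`-torsion of `p ^ N j G`, suitable multiples `z j` of
witnesses satisfy `p ^ j • z j = 0` and `f (z j) ∈ L`. Torsion-completeness of `T` extends `e j ↦ z
j` to the torsion part of `∏ ℤ/p^j` (`IsTorsionComplete.exists_hom`), and the composite with `f`
still lands in `L`. As `L` is thin, the composite is small, so it kills `p ^ n • e (n + k)` for some
`n`, contradicting the choice of `y`. -/

lemma IsPrimary.exists_nsmul_zsmul_eq (hG : IsPrimary p G) {q : ℕ}
    (hq : q.Coprime p) (g : G) : ∃ t : ℤ, q • (t • g) = g := by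
  obtain ⟨k, hk⟩ := hG g
  have h1 : Nat.gcd q (p ^ k) = 1 := Nat.Coprime.pow_right k hq
  have h2 := Nat.gcd_eq_gcd_ab q (p ^ k)
  rw [h1] at h2
  refine ⟨Nat.gcdA q (p ^ k), ?_⟩
  have h3 : g = (((q : ℤ) * Nat.gcdA q (p ^ k)) + ((p ^ k : ℕ) : ℤ) * Nat.gcdB q (p ^ k)) • g := by
    rw [← h2]; simp
  rw [add_smul, mul_comm ((p ^ k : ℕ) : ℤ), mul_smul, mul_smul, natCast_zsmul, natCast_zsmul, hk,
    smul_zero, add_zero] at h3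
  exact h3.symm

/-- A family of elements `b i` of order `p ^ (m i + 1)` such that for every `n` the elements
`p ^ n • b i` with `m i = n` form a basis of the socle of `p ^ n G` modulo `p ^ (n + 1) G`. -/
structure IsBasicFamily (p : ℕ) {ι : Type u} (m : ι → ℕ) (b : ι → G) : Prop where
  killed : ∀ i, p ^ (m i + 1) • b i = 0
  indep : ∀ (n : ℕ) (s : Finset ι) (c : ι → ℤ), (∀ i ∈ s, m i = n) →
    (∃ g : G, ∑ i ∈ s, c i • p ^ n • b i = p ^ (n + 1) • g) → ∀ i ∈ s, (p : ℤ) ∣ c i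
  span : ∀ (n : ℕ) (y : G), p ^ (n + 1) • y = 0 →
    ∃ (s : Finset ι) (c : ι → ℤ), (∀ i ∈ s, m i = n) ∧
      ∃ g : G, p ^ n • y = ∑ i ∈ s, c i • p ^ n • b i + p ^ (n + 1) • g

lemma exists_basis_of_zmodModule [Fact p.Prime] [Module (ZMod p) G] :
    ∃ (J : Type u) (v : J → G),
      (∀ (s : Finset J) (c : J → ℤ), ∑ i ∈ s, c i • v i = 0 → ∀ i ∈ s, (p : ℤ) ∣ c i) ∧
      ∀ w : G, ∃ (s : Finset J) (c : J → ℤ), ∑ i ∈ s, c i • v i = w := by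
  let v := Module.Basis.ofVectorSpace (ZMod p) G
  refine ⟨_, v, ?_, ?_⟩
  · intro s c h i hi
    refine (ZMod.intCast_zmod_eq_zero_iff_dvd _ _).1
      (linearIndependent_iff'.1 v.linearIndependent s (fun i => (c i : ZMod p)) ?_ i hi)
    simpa only [Int.cast_smul_eq_zsmul] using h
  · intro w
    refine ⟨(v.repr w).support, fun i => ((v.repr w i).cast : ℤ), ?_⟩
    have h := v.linearCombination_repr w
    rw [Finsupp.linearCombination_apply, Finsupp.sum] at h
    conv_rhs => rw [← h]
    refine Finset.sum_congr rfl fun i _ => ?_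
    rw [← Int.cast_smul_eq_zsmul (ZMod p), ZMod.intCast_zmod_cast]

lemma exists_basis_of_nsmul_eq_zero (hp : p.Prime) (hG : ∀ w : G, p • w = 0) :
    ∃ (J : Type u) (v : J → G),
      (∀ (s : Finset J) (c : J → ℤ), ∑ i ∈ s, c i • v i = 0 → ∀ i ∈ s, (p : ℤ) ∣ c i) ∧
      ∀ w : G, ∃ (s : Finset J) (c : J → ℤ), ∑ i ∈ s, c i • v i = w :=
  have : Fact p.Prime := ⟨hp⟩
  have : Module (ZMod p) G := AddCommGroup.zmodModule hG
  exists_basis_of_zmodModule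

/-- Multiplication by `p ^ n` sends `G[p^(n+1)]` onto a subgroup of `G / p^(n+1) G` killed by `p`;
the family lifts an `F_p`-basis of that image. -/
lemma exists_basic_layer (hp : p.Prime) (n : ℕ) :
    ∃ (I : Type u) (b : I → G), (∀ i, p ^ (n + 1) • b i = 0) ∧
    (∀ (s : Finset I) (c : I → ℤ),
      (∃ g : G, ∑ i ∈ s, c i • p ^ n • b i = p ^ (n + 1) • g) → ∀ i ∈ s, (p : ℤ) ∣ c i) ∧
    (∀ y : G, p ^ (n + 1) • y = 0 → ∃ (s : Finset I) (c : I → ℤ),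
      ∃ g : G, p ^ n • y = ∑ i ∈ s, c i • p ^ n • b i + p ^ (n + 1) • g) := by
  let N : AddSubgroup G := (nsmulAddMonoidHom (α := G) (p ^ (n + 1))).range
  let K : AddSubgroup G := (nsmulAddMonoidHom (α := G) (p ^ (n + 1))).ker
  let F : K →+ G ⧸ N := (QuotientAddGroup.mk' N).comp
    ((nsmulAddMonoidHom (α := G) (p ^ n)).comp K.subtype)
  have hF : ∀ y : K, F y = ((p ^ n • (y : G) : G) : G ⧸ N) := fun y => rfl
  have hK : ∀ y : G, y ∈ K ↔ p ^ (n + 1) • y = 0 := fun y => Iff.rfl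
  have hW : ∀ w : F.range, p • w = 0 := by
    rintro ⟨w, y, rfl⟩
    apply Subtype.ext
    change p • F y = 0
    rw [← map_nsmul, hF]
    have : p ^ n • ((p • y : K) : G) = 0 := by
      rw [AddSubgroup.coe_nsmul, ← mul_smul, ← pow_succ]
      exact (hK _).1 y.2
    rw [this]; rfl
  obtain ⟨J, v, hind, hspan⟩ := exists_basis_of_nsmul_eq_zero hp hW
  have hv : ∀ i, ∃ y : K, F y = (v i : G ⧸ N) := fun i => (v i).2
  choose y hy using hv
  have hsum : ∀ (s : Finset J) (c : J → ℤ),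
      ((∑ i ∈ s, c i • p ^ n • (y i : G) : G) : G ⧸ N)
        = ((∑ i ∈ s, c i • v i : F.range) : G ⧸ N) := by
    intro s c
    have h1 : ((∑ i ∈ s, c i • p ^ n • (y i : G) : G) : G ⧸ N)
        = QuotientAddGroup.mk' N (∑ i ∈ s, c i • p ^ n • (y i : G)) := rfl
    rw [h1, map_sum, AddSubgroup.val_finsetSum]
    refine Finset.sum_congr rfl fun i _ => ?_
    rw [map_zsmul, AddSubgroup.coe_zsmul, ← hy, hF]
    rfl
  refine ⟨J, fun i => (y i : G), fun i => (hK _).1 (y i).2, ?_, ?_⟩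
  · rintro s c ⟨g, hg⟩
    have h1 := hsum s c
    have h2 : ((p ^ (n + 1) • g : G) : G ⧸ N) = 0 := (QuotientAddGroup.eq_zero_iff _).2 ⟨g, rfl⟩
    rw [hg, h2] at h1
    exact hind s c (Subtype.ext h1.symm)
  · intro z hz
    obtain ⟨s, c, hc⟩ := hspan ⟨F ⟨z, hz⟩, ⟨z, hz⟩, rfl⟩
    have h1 := hsum s c
    rw [hc] at h1
    have h3 : ((∑ i ∈ s, c i • p ^ n • (y i : G) : G) : G ⧸ N)
      = ((p ^ n • z : G) : G ⧸ N) := h1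
    rw [QuotientAddGroup.eq] at h3
    obtain ⟨g, hg⟩ := h3
    refine ⟨s, c, g, ?_⟩
    have hg' : p ^ (n + 1) • g = _ := hg
    rw [hg']; abel

variable (p G) in
lemma exists_isBasicFamily (hp : p.Prime) :
    ∃ (ι : Type u) (m : ι → ℕ) (b : ι → G), IsBasicFamily p m b := by
  classical
  choose I b hk hi hs using fun n => exists_basic_layer (p := p) (G := G) hp n
  refine ⟨Σ n, I n, Sigma.fst, fun x => b x.1 x.2, fun i => hk _ _, ?_, ?_⟩
  · intro n s c hs hg i his
    have hinj : Function.Injective (Sigma.mk n : I n → Σ n, I n) := sigma_mk_injective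
    obtain ⟨t, rfl⟩ : ∃ t : Finset (I n), s = t.image (Sigma.mk n) := by
      refine ⟨s.preimage (Sigma.mk n) hinj.injOn, ?_⟩
      ext ⟨k, x⟩
      simp only [Finset.mem_image, Finset.mem_preimage]
      constructor
      · intro h
        obtain rfl : k = n := hs _ h
        exact ⟨x, h, rfl⟩
      · rintro ⟨a, ha, h⟩
        rwa [h] at ha
    rw [Finset.sum_image hinj.injOn] at hg
    obtain ⟨x, hx, rfl⟩ := Finset.mem_image.1 his
    exact hi n t (fun x => c ⟨n, x⟩) hg x hx
  · intro n y hy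
    obtain ⟨s, c, g, hg⟩ := hs n y hy
    refine ⟨s.image (Sigma.mk n),
      fun x => if h : x.1 = n then c (h ▸ x.2) else 0, by simp, g, ?_⟩
    rw [Finset.sum_image sigma_mk_injective.injOn]
    simpa using hg

variable {ι : Type u} {m : ι → ℕ} {b : ι → G}

/-- This one divisibility yields independence, purity and the coordinate endomorphisms. In the
induction, an index failing at `n + 1` has `n ≤ m i` and `c i = p ^ n * e i` with `p ∤ e i`, while
all other terms lie in `p ^ (n + 1) G`. -/
lemma IsBasicFamily.pow_min_dvd (h : IsBasicFamily p m b) (n : ℕ) :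
    ∀ (s : Finset ι) (c : ι → ℤ), (∃ g : G, ∑ i ∈ s, c i • b i = p ^ n • g) →
      ∀ i ∈ s, (p : ℤ) ^ min n (m i + 1) ∣ c i := by
  classical
  induction n with
  | zero => intros; simp
  | succ n ih =>
    rintro s c ⟨g, hg⟩
    have ih' := ih s c ⟨p • g, by rw [hg, pow_succ, mul_smul]⟩
    by_contra! hcon
    let F := s.filter fun i => ¬ (p : ℤ) ^ min (n + 1) (m i + 1) ∣ c i
    have hFne : F.Nonempty := by
      obtain ⟨i, hi, hi'⟩ := hcon
      exact ⟨i, Finset.mem_filter.2 ⟨hi, hi'⟩⟩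
    have hFm : ∀ i ∈ F, n ≤ m i := by
      intro i hi
      obtain ⟨his, hi⟩ := Finset.mem_filter.1 hi
      by_contra hlt
      apply hi
      have := ih' i his
      rwa [show min (n + 1) (m i + 1) = min n (m i + 1) by omega]
    have hFc : ∀ i ∈ F, ∃ e : ℤ, c i = (p : ℤ) ^ n * e ∧ ¬ (p : ℤ) ∣ e := by
      intro i hi
      have hm := hFm i hi
      obtain ⟨his, hi⟩ := Finset.mem_filter.1 hi
      obtain ⟨e, he⟩ := ih' i his
      rw [min_eq_left (by omega)] at he
      refine ⟨e, he, ?_⟩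
      rintro ⟨f, rfl⟩
      apply hi
      rw [min_eq_left (by omega), he, pow_succ]
      exact ⟨f, by ring⟩
    choose! e he hpe using hFc
    have hrest : ∀ i ∈ s.filter (fun i => ¬ ¬ (p : ℤ) ^ min (n + 1) (m i + 1) ∣ c i),
        c i • b i ∈ (nsmulAddMonoidHom (α := G) (p ^ (n + 1))).range := by
      intro i hi
      obtain ⟨his, hi⟩ := Finset.mem_filter.1 hi
      obtain ⟨d, hd⟩ := not_not.1 hi
      rcases le_total (n + 1) (m i + 1) with hle | hle
      · refine ⟨d • b i, ?_⟩
        rw [min_eq_left hle] at hd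
        simp only [nsmulAddMonoidHom_apply]
        rw [hd, mul_smul, ← Nat.cast_pow, natCast_zsmul]
      · rw [min_eq_right hle] at hd
        rw [hd, mul_comm, mul_smul, ← Nat.cast_pow, natCast_zsmul, h.killed, smul_zero]
        exact zero_mem _
    obtain ⟨g', hg'⟩ := sum_mem hrest
    have hFsum : ∑ i ∈ F, c i • b i = p ^ (n + 1) • (g - g') := by
      have h1 := Finset.sum_filter_add_sum_filter_not s
        (fun i => ¬ (p : ℤ) ^ min (n + 1) (m i + 1) ∣ c i) (fun i => c i • b i)
      rw [hg, ← hg'] at h1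
      simp only [nsmulAddMonoidHom_apply] at h1
      rw [smul_sub, ← h1]
      simp [F]
    -- Multiplying by `p ^ (m j - n)` with `m j` maximal kills the failing terms of smaller `m`,
    -- leaving a relation inside a single layer.
    obtain ⟨j, hjF, hj⟩ := F.exists_max_image m hFne
    have hMn := hFm j hjF
    refine hpe j hjF (h.indep (m j) (F.filter fun i => m i = m j) e (by simp)
      ⟨g - g', ?_⟩ j (by simp [hjF]))
    have h2 : ∑ i ∈ F, e i • p ^ m j • b i = p ^ (m j + 1) • (g - g') := by
      rw [show m j + 1 = (m j - n) + (n + 1) by omega, pow_add, mul_smul, ← hFsum, Finset.smul_sum]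
      refine Finset.sum_congr rfl fun i hi => ?_
      rw [he i hi, mul_comm, mul_smul, ← Nat.cast_pow, natCast_zsmul, smul_comm _ (e i), ← mul_smul (p ^ (m j - n)),
        ← pow_add, Nat.sub_add_cancel hMn]
    rw [← h2]
    refine Finset.sum_subset (Finset.filter_subset _ _) fun i hi hni => ?_
    have hlt : m i + 1 ≤ m j := by
      have := hj i hi
      have : m i ≠ m j := fun hh => hni (Finset.mem_filter.2 ⟨hi, hh⟩)
      omega
    rw [show m j = (m j - (m i + 1)) + (m i + 1) by omega, pow_add, mul_smul, h.killed, smul_zero,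
      smul_zero]

lemma IsBasicFamily.pow_min_dvd_of_linearCombination (h : IsBasicFamily p m b) {n : ℕ}
    {c : ι →₀ ℤ} {g : G} (hg : Finsupp.linearCombination ℤ b c = p ^ n • g) (i : ι) :
    (p : ℤ) ^ min n (m i + 1) ∣ c i := by
  by_cases hi : i ∈ c.support
  · exact h.pow_min_dvd n c.support c ⟨g, hg⟩ i hi
  · rw [Finsupp.notMem_support_iff.1 hi]; exact dvd_zero _

/-- Modulo `pG`, subtracting a combination from the right layer lowers the exponent of an element;
iterating on the remainder reaches `p ^ n G`. -/
lemma IsBasicFamily.exists_linearCombination_add (h : IsBasicFamily p m b) (hG : IsPrimary p G)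
    (n : ℕ) (g : G) :
    ∃ (c : ι →₀ ℤ) (x : G), g = Finsupp.linearCombination ℤ b c + p ^ n • x := by
  have hone : ∀ (r : ℕ) (g : G), p ^ r • g = 0 →
      ∃ (c : ι →₀ ℤ) (x : G), g = Finsupp.linearCombination ℤ b c + p • x := by
    intro r
    induction r with
    | zero => intro g hg; exact ⟨0, 0, by simpa using hg⟩
    | succ r ih =>
      intro g hg
      obtain ⟨s, c, -, x, hx⟩ := h.span r g hg
      obtain ⟨d, y, hy⟩ := ih (g - ∑ i ∈ s, c i • b i - p • x) (by
        rw [smul_sub, smul_sub, hx, Finset.smul_sum, ← mul_smul, ← pow_succ,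
          Finset.sum_congr rfl fun i _ => smul_comm (p ^ r) (c i) (b i)]
        abel)
      refine ⟨d + ∑ i ∈ s, Finsupp.single i (c i), y + x, ?_⟩
      have : g = (g - ∑ i ∈ s, c i • b i - p • x) + (∑ i ∈ s, c i • b i + p • x) := by abel
      rw [this, hy]
      simp only [map_add, map_sum, Finsupp.linearCombination_single, smul_add]
      abel
  induction n generalizing g with
  | zero => exact ⟨0, g, by simp⟩
  | succ n ih =>
    obtain ⟨c, x, hx⟩ := ih g
    obtain ⟨r, hr⟩ := hG x
    obtain ⟨d, y, hy⟩ := hone r x hr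
    refine ⟨c + p ^ n • d, y, ?_⟩
    rw [hx, hy, map_add, map_nsmul, smul_add, pow_succ, mul_smul, add_assoc]

/-- Modulo `p ^ (m i + 1) G` every element is a combination of the `b`'s whose `i`-th coefficient is
well defined mod `p ^ (m i + 1)`, which is enough to multiply `z`. -/
lemma IsBasicFamily.exists_endomorphism (h : IsBasicFamily p m b) (hG : IsPrimary p G) (i : ι)
    (z : G) (hz : p ^ (m i + 1) • z = 0) :
    ∃ φ : G →+ G, ∀ c : ι →₀ ℤ, φ (Finsupp.linearCombination ℤ b c) = c i • z := by
  let A : (ι →₀ ℤ) × G →+ G :=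
    (Finsupp.linearCombination ℤ b).toAddMonoidHom.coprod (nsmulAddMonoidHom (p ^ (m i + 1)))
  let C : (ι →₀ ℤ) × G →+ G :=
    ((zmultiplesHom G z).comp (Finsupp.applyAddHom i)).comp (AddMonoidHom.fst _ _)
  have hA : Function.Surjective A := fun g => by
    obtain ⟨c, x, hx⟩ := h.exists_linearCombination_add hG (m i + 1) g
    exact ⟨(c, x), by simp [A, hx]⟩
  have hAC : A.ker ≤ C.ker := by
    rintro ⟨c, x⟩ hx
    have hx' : Finsupp.linearCombination ℤ b c + p ^ (m i + 1) • x = 0 := hx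
    have h1 : Finsupp.linearCombination ℤ b c = p ^ (m i + 1) • (-x) := by
      rw [smul_neg]; exact eq_neg_of_add_eq_zero_left hx'
    have h2 := h.pow_min_dvd_of_linearCombination h1 i
    rw [min_self] at h2
    obtain ⟨d, hd⟩ := h2
    change c i • z = 0
    rw [hd, mul_comm, mul_smul, ← Nat.cast_pow, natCast_zsmul, hz, smul_zero]
  refine ⟨A.liftOfSurjective hA ⟨C, hAC⟩, fun c => ?_⟩
  have h3 := A.liftOfRightInverse_comp_apply _ (Function.rightInverse_surjInv hA) ⟨C, hAC⟩ (c, 0)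
  have h4 : A (c, 0) = Finsupp.linearCombination ℤ b c := by simp [A]
  rw [h4] at h3
  exact h3

lemma IsBasicFamily.isBasicSubgroup_range (h : IsBasicFamily p m b) (hp : p.Prime)
    (hG : IsPrimary p G) :
    IsBasicSubgroup (Finsupp.linearCombination ℤ b).toAddMonoidHom.range := by
  classical
  have hfac : ∀ n : ℕ, n ≠ 0 → ∃ r q : ℕ, q.Coprime p ∧ n = p ^ r * q := fun n hn => by
    obtain ⟨r, q, hq, hn⟩ := Nat.exists_eq_pow_mul_and_not_dvd hn p hp.ne_one
    exact ⟨r, q, ((Nat.Prime.coprime_iff_not_dvd hp).2 hq).symm, hn⟩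
  refine ⟨?_, ?_, ?_⟩
  · let f : ∀ i, ZMod (p ^ (m i + 1)) →+ G := fun i =>
      ZMod.lift _ ⟨zmultiplesHom G (b i), by
        rw [zmultiplesHom_apply, natCast_zsmul, h.killed]⟩
    have hf : ∀ i x, f i x = (x.cast : ℤ) • b i := fun i x => by
      conv_lhs => rw [← ZMod.intCast_zmod_cast x]
      simp [f, -ZMod.intCast_cast]
    let Φ : (⨁ i, ZMod (p ^ (m i + 1))) →+ G := DirectSum.toAddMonoid f
    have hinj : Function.Injective Φ := by
      rw [injective_iff_map_eq_zero]
      intro a ha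
      have h1 : ∑ i ∈ DFinsupp.support a, ((a i).cast : ℤ) • b i = 0 := by
        rw [← ha]
        change _ = DFinsupp.sumAddHom f a
        rw [DFinsupp.sumAddHom_apply, DFinsupp.sum]
        exact Finset.sum_congr rfl fun i _ => (hf i _).symm
      refine DFinsupp.ext fun i => ?_
      by_contra hne
      have hi : i ∈ DFinsupp.support a := DFinsupp.mem_support_iff.2 hne
      have h2 := h.pow_min_dvd (m i + 1) _ _ ⟨0, by rw [h1, smul_zero]⟩ i hi
      rw [min_self, ← Nat.cast_pow, ← ZMod.intCast_zmod_eq_zero_iff_dvd,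
        ZMod.intCast_zmod_cast] at h2
      exact hne h2
    have hrange : Φ.range = (Finsupp.linearCombination ℤ b).toAddMonoidHom.range := by
      apply le_antisymm
      · rintro _ ⟨a, rfl⟩
        induction a using DirectSum.induction_on with
        | zero => simp
        | of i x =>
          refine ⟨Finsupp.single i (x.cast : ℤ), ?_⟩
          simp only [Φ, DirectSum.toAddMonoid_of, hf]
          simp
        | add x y hx hy => rw [map_add]; exact add_mem hx hy
      · rintro _ ⟨c, rfl⟩
        change Finsupp.linearCombination ℤ b c ∈ _
        rw [Finsupp.linearCombination_apply]
        refine sum_mem fun i _ => zsmul_mem ?_ _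
        refine ⟨DirectSum.of _ i 1, ?_⟩
        simp only [Φ, DirectSum.toAddMonoid_of]
        have : f i ((1 : ℤ) : ZMod (p ^ (m i + 1))) = b i := by simp [f, -Int.cast_one]
        simpa using this
    rw [← hrange]
    exact ⟨ι, fun i => p ^ (m i + 1), ⟨(AddMonoidHom.ofInjective hinj).symm⟩⟩
  · rintro n g ⟨c, hc⟩
    rcases eq_or_ne n 0 with rfl | hn
    · exact ⟨0, zero_mem _, by simp⟩
    obtain ⟨r, q, hq, rfl⟩ := hfac n hn
    have hc' : Finsupp.linearCombination ℤ b c = p ^ r • (q • g) := by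
      rw [← mul_smul]; exact hc
    have hdvd := h.pow_min_dvd_of_linearCombination hc'
    have hmem : ∃ d : ι →₀ ℤ, p ^ r • Finsupp.linearCombination ℤ b d
        = Finsupp.linearCombination ℤ b c := by
      have : Finsupp.linearCombination ℤ b c ∈ ((nsmulAddMonoidHom (α := G) (p ^ r)).comp
          (Finsupp.linearCombination ℤ b).toAddMonoidHom).range := by
        rw [Finsupp.linearCombination_apply]
        refine sum_mem fun i _ => ?_
        obtain ⟨d, hd⟩ := hdvd i
        rcases le_total r (m i + 1) with hle | hle
        · rw [min_eq_left hle] at hd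
          refine ⟨Finsupp.single i d, ?_⟩
          change p ^ r • Finsupp.linearCombination ℤ b (Finsupp.single i d) = c i • b i
          rw [hd, Finsupp.linearCombination_single, mul_smul, ← Nat.cast_pow, natCast_zsmul]
        · rw [min_eq_right hle] at hd
          have hz : c i • b i = 0 := by
            rw [hd, mul_comm, mul_smul, ← Nat.cast_pow, natCast_zsmul, h.killed, smul_zero]
          exact (congrArg (· ∈ _) hz).mpr (zero_mem _)
      exact this
    obtain ⟨d, hd⟩ := hmem
    obtain ⟨t, ht⟩ := hG.exists_nsmul_zsmul_eq hq (Finsupp.linearCombination ℤ b d)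
    refine ⟨t • Finsupp.linearCombination ℤ b d, ⟨t • d, map_zsmul _ t d⟩, ?_⟩
    rw [mul_smul, ht, hd]
    exact hc
  · intro n hn d
    obtain ⟨g, rfl⟩ := QuotientAddGroup.mk_surjective d
    obtain ⟨r, q, hq, rfl⟩ := hfac n hn
    obtain ⟨c, x, hx⟩ := h.exists_linearCombination_add hG r g
    obtain ⟨t, ht⟩ := hG.exists_nsmul_zsmul_eq hq x
    refine ⟨((t • x : G) : G ⧸ _), ?_⟩
    rw [← QuotientAddGroup.mk_nsmul, QuotientAddGroup.eq, mul_smul, ht]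
    refine ⟨c, ?_⟩
    rw [hx]
    change Finsupp.linearCombination ℤ b c = _
    abel

end Primary

/-! ### Large subgroups, Pierce's condition and small maps. -/

section Large

variable {p : ℕ} {G : Type u} [AddCommGroup G] {ι : Type u} {m : ι → ℕ} {b : ι → G}

/-- Pierce's condition: for every `k` the subgroup `K` contains `(p ^ n G)[p ^ k]` for some `n`. -/
def ContainsHighTorsion (p : ℕ) (K : AddSubgroup G) : Prop :=
  ∀ k : ℕ, ∃ n : ℕ, ∀ y : G, p ^ (n + k) • y = 0 → p ^ n • y ∈ K

lemma IsLarge.map_mem {L : AddSubgroup G} (hL : IsLarge L) (φ : G →+ G) {x : G} (hx : x ∈ L) :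
    φ x ∈ L :=
  hL.fullyInvariant φ.toIntLinearMap hx

/-- The perturbation is invisible in each layer: `p ^ n • e i` lies in `p ^ (n + 1) G`. -/
lemma IsBasicFamily.sub (h : IsBasicFamily p m b) {e : ι → G}
    (he : ∀ i, ∃ g : G, p ^ (m i + 2) • g = 0 ∧ e i = p • g) :
    IsBasicFamily p m (fun i => b i - e i) := by
  choose g hg heg using he
  have hsum : ∀ (n : ℕ) (s : Finset ι) (c : ι → ℤ),
      ∑ i ∈ s, c i • p ^ n • (b i - e i) =
        ∑ i ∈ s, c i • p ^ n • b i - p ^ (n + 1) • ∑ i ∈ s, c i • g i := by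
    intro n s c
    rw [Finset.smul_sum, ← Finset.sum_sub_distrib]
    refine Finset.sum_congr rfl fun i _ => ?_
    rw [heg, smul_sub, smul_sub, pow_succ, mul_smul, smul_comm p (c i), smul_comm (p ^ n) (c i)]
  refine ⟨fun i => ?_, ?_, ?_⟩
  · rw [smul_sub, h.killed, heg, ← mul_smul, ← pow_succ, hg, sub_zero]
  · rintro n s c hs ⟨x, hx⟩
    refine h.indep n s c hs ⟨x + ∑ i ∈ s, c i • g i, ?_⟩
    rw [hsum, sub_eq_iff_eq_add] at hx
    rw [hx, smul_add]
  · intro n y hy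
    obtain ⟨s, c, hs, x, hx⟩ := h.span n y hy
    refine ⟨s, c, hs, x + ∑ i ∈ s, c i • g i, ?_⟩
    rw [hsum, hx, smul_add]
    abel

lemma pow_dvd_pow_mul_of_zsmul_mem (hp : p.Prime) {L : AddSubgroup G} {x : G} {n k : ℕ}
    (hx : p ^ n • x = 0) (hnot : p ^ (n - k) • x ∉ L) {c : ℤ} (hc : c • x ∈ L) :
    (p : ℤ) ^ n ∣ (p : ℤ) ^ (k - 1) * c := by
  have hg : Int.gcd c ((p ^ n : ℕ) : ℤ) ∣ p ^ n := by
    have := Int.gcd_dvd_right c ((p ^ n : ℕ) : ℤ)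
    exact_mod_cast this
  obtain ⟨v, hv, hgv⟩ := (Nat.dvd_prime_pow hp).1 hg
  have hbez := Int.gcd_eq_gcd_ab c ((p ^ n : ℕ) : ℤ)
  have hmem : p ^ v • x ∈ L := by
    rw [← hgv, ← natCast_zsmul, hbez, add_smul, mul_comm, mul_smul,
      mul_comm ((p ^ n : ℕ) : ℤ), mul_smul, natCast_zsmul, hx, smul_zero, add_zero]
    exact zsmul_mem hc _
  have hlt : n - k < v := by
    by_contra hle
    apply hnot
    rw [show n - k = (n - k - v) + v by omega, pow_add, mul_smul]
    exact nsmul_mem hmem _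
  have hdc : (p : ℤ) ^ v ∣ c := by
    have := Int.gcd_dvd_left c ((p ^ n : ℕ) : ℤ)
    rw [hgv] at this
    exact_mod_cast this
  calc (p : ℤ) ^ n ∣ (p : ℤ) ^ (k - 1 + v) := pow_dvd_pow _ (by omega)
    _ = (p : ℤ) ^ (k - 1) * (p : ℤ) ^ v := pow_add _ _ _
    _ ∣ _ := mul_dvd_mul_left _ hdc

/-- If infinitely many members of a basic family are far from a fully invariant subgroup `L`, some
basic subgroup does not supplement `L`. -/
lemma IsBasicFamily.false_of_isLarge (h : IsBasicFamily p m b) (hp : p.Prime) (hG : IsPrimary p G)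
    {L : AddSubgroup G} (hL : IsLarge L) {k : ℕ} (i : ℕ → ι)
    (hi : StrictMono (m ∘ i)) (hki : k ≤ m (i 0))
    (hnot : ∀ j, p ^ (m (i j) + 1 - k) • b (i j) ∉ L) : False := by
  classical
  have hinj : Function.Injective i := fun a a' haa => hi.injective (congrArg m haa)
  have hlt : ∀ j, m (i j) < m (i (j + 1)) := fun j => hi j.lt_succ_self
  have hp0 : (p : ℚ) ≠ 0 := Nat.cast_ne_zero.2 hp.ne_zero
  -- The new family replaces `b (i j)` by `b (i j) - p ^ (m (i (j+1)) - m (i j)) • b (i (j+1))`. The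
  -- weights `w` are chosen so that the functional `Ψ` vanishes on all its members.
  let E : ι → ι →₀ ℤ :=
    Function.extend i (fun j => Finsupp.single (i (j + 1)) ((p : ℤ) ^ (m (i (j + 1)) - m (i j)))) 0
  let w : ι → ℚ := Function.extend i (fun j => 1 / (p : ℚ) ^ (m (i j) + 1)) 0
  let Ψ : (ι →₀ ℤ) →ₗ[ℤ] ℚ := Finsupp.linearCombination ℤ w
  let S : (ι →₀ ℤ) →ₗ[ℤ] (ι →₀ ℤ) :=
    Finsupp.linearCombination ℤ fun x => Finsupp.single x 1 - E x
  have hwi : ∀ j, w (i j) = 1 / (p : ℚ) ^ (m (i j) + 1) := fun j => hinj.extend_apply _ _ _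
  have hΨE : ∀ x, Ψ (E x) = w x := by
    intro x
    by_cases hx : ∃ j, i j = x
    · obtain ⟨j, rfl⟩ := hx
      simp only [Ψ, E, hinj.extend_apply, Finsupp.linearCombination_single, hwi]
      have : m (i (j + 1)) + 1 = (m (i (j + 1)) - m (i j)) + (m (i j) + 1) := by
        have := hlt j; omega
      rw [this, pow_add, zsmul_eq_mul]
      push_cast
      field_simp
    · simp [Ψ, E, w, Function.extend_apply' _ _ _ hx]
  have hΨS : ∀ d, Ψ (S d) = 0 := by
    intro d
    have : Ψ ∘ₗ S = 0 := by
      ext x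
      simp only [S, LinearMap.comp_apply, Finsupp.lsingle_apply, Finsupp.linearCombination_single,
        one_smul, map_sub, hΨE]
      simp [Ψ]
    exact LinearMap.congr_fun this d
  have hfam : IsBasicFamily p m (fun x => b x - Finsupp.linearCombination ℤ b (E x)) := by
    refine h.sub fun x => ?_
    by_cases hx : ∃ j, i j = x
    · obtain ⟨j, rfl⟩ := hx
      have := hlt j
      refine ⟨p ^ (m (i (j + 1)) - m (i j) - 1) • b (i (j + 1)), ?_, ?_⟩
      · rw [← mul_smul, ← pow_add, show m (i j) + 2 + (m (i (j + 1)) - m (i j) - 1)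
          = m (i (j + 1)) + 1 by omega, h.killed]
      · simp only [E, hinj.extend_apply, Finsupp.linearCombination_single]
        rw [← mul_smul, ← pow_succ', show m (i (j + 1)) - m (i j) - 1 + 1
          = m (i (j + 1)) - m (i j) by omega, ← Nat.cast_pow, natCast_zsmul]
    · exact ⟨0, by simp, by simp [E, Function.extend_apply' _ _ _ hx]⟩
  have hcomb : ∀ d, Finsupp.linearCombination ℤ
      (fun x => b x - Finsupp.linearCombination ℤ b (E x)) d
        = Finsupp.linearCombination ℤ b (S d) := by
    intro d
    have : Finsupp.linearCombination ℤ (fun x => b x - Finsupp.linearCombination ℤ b (E x))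
        = Finsupp.linearCombination ℤ b ∘ₗ S := by
      ext x
      simp [S]
    exact LinearMap.congr_fun this d
  have htop := hL.sup_basic _ (hfam.isBasicSubgroup_range hp hG)
  obtain ⟨l, hl, _, ⟨d, rfl⟩, hld⟩ := AddSubgroup.mem_sup.1
    (htop.symm ▸ AddSubgroup.mem_top (b (i 0)) : b (i 0) ∈ L ⊔ _)
  have hld' : l + Finsupp.linearCombination ℤ b (S d) = b (i 0) := by
    rw [← hcomb]; exact hld
  let c : ι →₀ ℤ := Finsupp.single (i 0) 1 - S d
  have hcl : Finsupp.linearCombination ℤ b c = l := by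
    simp [c, ← hld']
  have hΨc : Ψ c = 1 / (p : ℚ) ^ (m (i 0) + 1) := by
    simp only [c, map_sub, hΨS, sub_zero]
    simp [Ψ, hwi]
  have hcL : ∀ x, c x • b x ∈ L := by
    intro x
    obtain ⟨φ, hφ⟩ := h.exists_endomorphism hG x (b x) (h.killed x)
    rw [← hφ, hcl]
    exact hL.map_mem φ hl
  -- Each coordinate `c x • b x` lies in `L`, so the hypothesis on `L` bounds the denominators of `Ψ
  -- c` by `p ^ (k - 1)`; but `Ψ c` is `1 / p ^ (m (i 0) + 1)`.
  have hint : (p : ℚ) ^ (k - 1) * Ψ c ∈ (Int.castAddHom ℚ).range := by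
    simp only [Ψ, Finsupp.linearCombination_apply, Finsupp.sum, Finset.mul_sum]
    refine sum_mem fun x _ => ?_
    by_cases hx : ∃ j, i j = x
    · obtain ⟨j, rfl⟩ := hx
      obtain ⟨a, ha⟩ := pow_dvd_pow_mul_of_zsmul_mem hp (h.killed (i j)) (hnot j) (hcL (i j))
      refine ⟨a, ?_⟩
      have ha' : (p : ℚ) ^ (k - 1) * c (i j) = (p : ℚ) ^ (m (i j) + 1) * a := by exact_mod_cast ha
      rw [hwi, zsmul_eq_mul, ← mul_assoc, ha']
      simp only [Int.coe_castAddHom]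
      field_simp
    · have : w x = 0 := by simp [w, Function.extend_apply' _ _ _ hx]
      rw [this, smul_zero, mul_zero]
      exact zero_mem _
  obtain ⟨a, ha⟩ := hint
  rw [hΨc, mul_one_div, eq_div_iff (pow_ne_zero _ hp0)] at ha
  simp only [Int.coe_castAddHom] at ha
  have hdvd : (p : ℤ) ^ (m (i 0) + 1) ∣ (p : ℤ) ^ (k - 1) :=
    ⟨a, by rw [mul_comm]; exact_mod_cast ha.symm⟩
  have hdvd' : p ^ (m (i 0) + 1) ∣ p ^ (k - 1) := by exact_mod_cast hdvd
  have := (Nat.pow_dvd_pow_iff_le_right hp.one_lt).1 hdvd'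
  omega

theorem IsLarge.containsHighTorsion (hp : p.Prime) (hG : IsPrimary p G) {L : AddSubgroup G}
    (hL : IsLarge L) : ContainsHighTorsion p L := by
  intro k
  by_contra! hcon
  obtain ⟨ι, m, b, h⟩ := exists_isBasicFamily p G hp
  -- If the orders were bounded, `p ^ (N + 1)` would kill the basic subgroup, and `G = L + B` would
  -- give `p ^ (N + 1) G ≤ L`.
  have hunb : ∀ N, ∃ x, N < m x := by
    by_contra! hb
    obtain ⟨N, hN⟩ := hb
    obtain ⟨y, -, hy⟩ := hcon (N + 1)
    apply hy
    obtain ⟨l, hl, _, ⟨c, rfl⟩, hlc⟩ := AddSubgroup.mem_sup.1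
      ((hL.sup_basic _ (h.isBasicSubgroup_range hp hG)).symm ▸ AddSubgroup.mem_top y : y ∈ L ⊔ _)
    have hz : p ^ (N + 1) • Finsupp.linearCombination ℤ b c = 0 := by
      rw [Finsupp.linearCombination_apply, Finsupp.sum, Finset.smul_sum]
      refine Finset.sum_eq_zero fun x _ => ?_
      rw [smul_comm, show N + 1 = (N - m x) + (m x + 1) by have := hN x; omega, pow_add, mul_smul,
        h.killed, smul_zero, smul_zero]
    have hlc' : l + Finsupp.linearCombination ℤ b c = y := hlc
    rw [← hlc', smul_add, hz, add_zero]
    exact nsmul_mem hl _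
  have hnot : ∀ x, k ≤ m x + 1 → p ^ (m x + 1 - k) • b x ∉ L := by
    intro x hkx hx
    obtain ⟨y, hy, hy'⟩ := hcon (m x + 1 - k)
    rw [Nat.sub_add_cancel hkx] at hy
    obtain ⟨φ, hφ⟩ := h.exists_endomorphism hG x y hy
    have hφb : φ (b x) = y := by
      have := hφ (Finsupp.single x 1)
      simpa using this
    apply hy'
    rw [← hφb, ← map_nsmul]
    exact hL.map_mem φ hx
  choose nx hnx using hunb
  let i : ℕ → ι := fun j => Nat.rec (nx k) (fun _ x => nx (m x)) j
  have hi : StrictMono (m ∘ i) := strictMono_nat_of_lt_succ fun j => hnx (m (i j))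
  have hki : k ≤ m (i 0) := (hnx k).le
  refine h.false_of_isLarge hp hG hL i hi hki fun j => hnot _ ?_
  have : m (i 0) ≤ m (i j) := hi.monotone (Nat.zero_le j)
  omega

theorem isSmall_of_containsHighTorsion_ker {H : Type u} [AddCommGroup H]
    (hp : p.Prime) (hG : IsPrimary p G) (f : G →+ H) (hf : ContainsHighTorsion p f.ker) :
    IsSmall f := by
  -- The largest fully invariant subgroup inside the kernel. It keeps the same bounds `n`, because
  -- endomorphisms preserve the condition on `y`.
  let K : AddSubgroup G := ⨅ φ : G →+ G, f.ker.comap φ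
  have hK : ∀ x, x ∈ K ↔ ∀ φ : G →+ G, f (φ x) = 0 := fun x => by
    simp [K, AddSubgroup.mem_iInf, AddMonoidHom.mem_ker]
  refine ⟨K, ⟨?_, ?_⟩, fun x hx => (hK x).1 hx (AddMonoidHom.id G)⟩
  · intro ψ x hx
    exact (hK _).2 fun φ => (hK x).1 hx (φ.comp ψ.toAddMonoidHom)
  · intro B hB
    rw [eq_top_iff]
    rintro x -
    obtain ⟨k, hk⟩ := hG x
    obtain ⟨n, hn⟩ := hf k
    obtain ⟨d, hd⟩ := hB.divisible (p ^ n) (pow_ne_zero _ hp.ne_zero) (x : G ⧸ B)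
    obtain ⟨y, rfl⟩ := QuotientAddGroup.mk_surjective d
    rw [← QuotientAddGroup.mk_nsmul, QuotientAddGroup.eq] at hd
    have hy : p ^ (n + k) • y ∈ B := by
      have := neg_mem (nsmul_mem hd (p ^ k))
      rwa [smul_add, hk, add_zero, smul_neg, neg_neg, ← mul_smul, ← pow_add, add_comm] at this
    obtain ⟨c, hcB, hc⟩ := hB.pure _ _ hy
    have hx : x = p ^ n • (y - c) + (p ^ n • c + (-(p ^ n • y) + x)) := by
      rw [smul_sub]; abel
    rw [hx]
    refine AddSubgroup.add_mem_sup ((hK _).2 fun φ => ?_) (add_mem (nsmul_mem hcB _) hd)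
    rw [map_nsmul]
    apply hn
    rw [← map_nsmul, smul_sub, hc, sub_self, map_zero]

end Large

/-! ### Limits in torsion-complete groups and the test group. -/

section TorsionComplete

variable {p : ℕ} {T : Type u} [AddCommGroup T]

lemma mem_span_pow_smul_top {n : ℕ} {x : T} :
    x ∈ (Ideal.span {(p : ℤ)} ^ n • ⊤ : Submodule ℤ T) ↔ ∃ y : T, x = p ^ n • y := by
  rw [Ideal.span_singleton_pow, Submodule.ideal_span_singleton_smul,
    Submodule.mem_smul_pointwise_iff_exists]
  constructor
  · rintro ⟨y, -, rfl⟩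
    exact ⟨y, by rw [← Nat.cast_pow, natCast_zsmul]⟩
  · rintro ⟨y, rfl⟩
    exact ⟨y, trivial, by rw [← Nat.cast_pow, natCast_zsmul]⟩

lemma adicCompletion_of_eq_mk_iff {t : T}
    {s : AdicCompletion.AdicCauchySequence (Ideal.span {(p : ℤ)}) T} :
    AdicCompletion.of (Ideal.span {(p : ℤ)}) T t = AdicCompletion.mk _ T s ↔
      ∀ n, ∃ y : T, t - s n = p ^ n • y := by
  rw [AdicCompletion.ext_iff]
  refine forall_congr' fun n => ?_
  rw [← mem_span_pow_smul_top, ← Submodule.Quotient.eq]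
  rfl

lemma adicCompletion_nsmul_mk_eq_zero_iff {m : ℕ}
    {s : AdicCompletion.AdicCauchySequence (Ideal.span {(p : ℤ)}) T} :
    m • AdicCompletion.mk _ T s = 0 ↔ ∀ n, ∃ y : T, m • s n = p ^ n • y := by
  rw [← map_nsmul, AdicCompletion.ext_iff]
  refine forall_congr' fun n => ?_
  rw [← mem_span_pow_smul_top, ← Submodule.Quotient.mk_eq_zero]
  rfl

lemma IsTorsionComplete.eq_zero (hT : IsTorsionComplete p T) {x : T}
    (hx : ∀ n, ∃ y : T, x = p ^ n • y) : x = 0 := by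
  refine (AdicCompletion.of_injective_iff.1 hT.injective).haus x fun n => ?_
  rw [SModEq.zero]
  exact mem_span_pow_smul_top.2 (hx n)

lemma IsTorsionComplete.exists_limit (hT : IsTorsionComplete p T) (hp : p.Prime) {s : ℕ → T}
    {r : ℕ} (hs : ∀ n, ∃ y : T, s (n + 1) - s n = p ^ n • y) (hr : ∀ n, p ^ r • s n = 0) :
    ∃ t : T, ∀ n, ∃ y : T, t - s n = p ^ n • y := by
  let σ : AdicCompletion.AdicCauchySequence (Ideal.span {(p : ℤ)}) T :=
    AdicCompletion.AdicCauchySequence.mk _ _ s fun n => by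
      rw [SModEq.comm, SModEq.sub_mem]
      exact mem_span_pow_smul_top.2 (hs n)
  have hσ : IsOfFinAddOrder (AdicCompletion.mk _ T σ) :=
    isOfFinAddOrder_iff_nsmul_eq_zero.2 ⟨p ^ r, pow_pos hp.pos r,
      adicCompletion_nsmul_mk_eq_zero_iff.2 fun n => ⟨0, (hr n).trans (smul_zero _).symm⟩⟩
  obtain ⟨t, ht⟩ := hT.range_eq.symm.subset hσ
  exact ⟨t, adicCompletion_of_eq_mk_iff.1 ht⟩

lemma isTorsionComplete_of_exists_limit (hp : p.Prime) (hprim : IsPrimary p T)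
    (hsep : ∀ x : T, (∀ n, ∃ y : T, x = p ^ n • y) → x = 0)
    (hlim : ∀ (s : ℕ → T) (k : ℕ), k ≠ 0 → (∀ n n', n ≤ n' → ∃ y : T, s n' - s n = p ^ n • y) →
      (∀ n, ∃ y : T, k • s n = p ^ n • y) → ∃ t : T, ∀ n, ∃ y : T, t - s n = p ^ n • y) :
    IsTorsionComplete p T := by
  refine ⟨hprim, AdicCompletion.of_injective_iff.2 ⟨fun x hx => hsep x fun n => ?_⟩, ?_⟩
  · exact mem_span_pow_smul_top.1 (SModEq.zero.1 (hx n))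
  · ext x
    constructor
    · rintro ⟨t, rfl⟩
      obtain ⟨k, hk⟩ := hprim t
      refine isOfFinAddOrder_iff_nsmul_eq_zero.2 ⟨p ^ k, pow_pos hp.pos k, ?_⟩
      rw [← map_nsmul, hk, map_zero]
    · intro hx
      obtain ⟨k, hk, hkx⟩ := isOfFinAddOrder_iff_nsmul_eq_zero.1 hx
      obtain ⟨s, rfl⟩ := AdicCompletion.mk_surjective _ T x
      obtain ⟨t, ht⟩ := hlim s k hk.ne' (fun n n' hn => mem_span_pow_smul_top.1
        (SModEq.sub_mem.1 (s.2 hn).symm)) (adicCompletion_nsmul_mk_eq_zero_iff.1 hkx)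
      exact ⟨t, adicCompletion_of_eq_mk_iff.2 ht⟩

/-- The torsion subgroup of `∏ j, ℤ/p^j`. -/
def torsionProduct (p : ℕ) : AddSubgroup (∀ j : ULift.{u} ℕ, ZMod (p ^ j.down)) where
  carrier := {a | ∃ r, p ^ r • a = 0}
  zero_mem' := ⟨0, smul_zero _⟩
  add_mem' := by
    rintro a a' ⟨r, hr⟩ ⟨r', hr'⟩
    refine ⟨r + r', ?_⟩
    rw [smul_add, pow_add, mul_smul, mul_smul, hr', smul_zero, smul_comm, hr, smul_zero, add_zero]
  neg_mem' := by
    rintro a ⟨r, hr⟩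
    exact ⟨r, by rw [smul_neg, hr, neg_zero]⟩

lemma torsionProduct_isPrimary : IsPrimary p (torsionProduct.{u} p) := by
  rintro ⟨a, r, hr⟩
  exact ⟨r, Subtype.ext hr⟩

lemma zmod_pow_nsmul_eq_zero (j : ℕ) (x : ZMod (p ^ j)) : p ^ j • x = 0 := by
  rw [nsmul_eq_mul, ZMod.natCast_self, zero_mul]

lemma zmod_exists_eq_pow_nsmul (hp : p.Prime) {j r : ℕ} (hrj : r ≤ j) {x : ZMod (p ^ j)}
    (hx : p ^ r • x = 0) : ∃ a : ℤ, x = ((p ^ (j - r) : ℕ) : ℤ) * a := by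
  rw [← ZMod.intCast_zmod_cast x, nsmul_eq_mul] at hx
  have h : (((p ^ r : ℕ) * (x.cast : ℤ) : ℤ) : ZMod (p ^ j)) = 0 := by push_cast at hx ⊢; exact hx
  rw [ZMod.intCast_zmod_eq_zero_iff_dvd] at h
  obtain ⟨a, ha⟩ := h
  refine ⟨a, ?_⟩
  have h2 : (x.cast : ℤ) = ((p ^ (j - r) : ℕ) : ℤ) * a := by
    have h0 : ((p ^ r : ℕ) : ℤ) ≠ 0 := Int.natCast_ne_zero.2 (pow_ne_zero _ hp.ne_zero)
    refine mul_left_cancel₀ h0 (ha.trans ?_)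
    rw [← mul_assoc, ← Nat.cast_mul, ← pow_add, Nat.add_sub_cancel' hrj]
  rw [← ZMod.intCast_zmod_cast x, h2, Int.cast_mul]

lemma isTorsionComplete_torsionProduct (hp : p.Prime) :
    IsTorsionComplete p (torsionProduct.{u} p) := by
  classical
  refine isTorsionComplete_of_exists_limit hp torsionProduct_isPrimary ?_ ?_
  · intro x hx
    refine Subtype.ext (funext fun j => ?_)
    obtain ⟨y, rfl⟩ := hx j.down
    exact zmod_pow_nsmul_eq_zero _ _
  · intro s k hk hs hks
    -- The `j`-th coordinate of `s` is constant from index `j` on, since `p ^ j` kills that factor.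
    let t : ∀ j : ULift.{u} ℕ, ZMod (p ^ j.down) := fun j => (s j.down).1 j
    have hts : ∀ (n : ℕ) (j : ULift.{u} ℕ), ∃ y : ZMod (p ^ j.down),
        t j - (s n).1 j = p ^ n • y := by
      intro n j
      rcases le_total n j.down with hn | hn
      · obtain ⟨y, hy⟩ := hs n j.down hn
        exact ⟨y.1 j, congrFun (congrArg Subtype.val hy) j⟩
      · obtain ⟨y, hy⟩ := hs j.down n hn
        have h1 : (s n).1 j - t j = p ^ j.down • y.1 j := congrFun (congrArg Subtype.val hy) j
        rw [zmod_pow_nsmul_eq_zero] at h1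
        exact ⟨0, by rw [sub_eq_zero.1 h1, sub_self, smul_zero]⟩
    have hkt : k • t = 0 := by
      funext j
      obtain ⟨y, hy⟩ := hks j.down
      have h1 : k • t j = p ^ j.down • y.1 j := congrFun (congrArg Subtype.val hy) j
      rw [zmod_pow_nsmul_eq_zero] at h1
      exact h1
    obtain ⟨r, q, hq, rfl⟩ := Nat.exists_eq_pow_mul_and_not_dvd hk p hp.ne_one
    have hqp : q.Coprime p := ((Nat.Prime.coprime_iff_not_dvd hp).2 hq).symm
    have ht : p ^ r • t = 0 := by
      funext j
      have hu : IsUnit ((q : ℕ) : ZMod (p ^ j.down)) :=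
        (ZMod.isUnit_iff_coprime _ _).2 (hqp.pow_right _)
      have h1 : (p ^ r * q) • t j = 0 := congrFun hkt j
      rw [mul_comm, mul_smul, nsmul_eq_mul] at h1
      exact hu.mul_right_eq_zero.1 h1
    refine ⟨⟨t, r, ht⟩, fun n => ?_⟩
    choose y hy using hts n
    have hy' : t - (s n).1 = p ^ n • y := funext hy
    obtain ⟨r', hr'⟩ := (sub_mem (⟨r, ht⟩ : t ∈ torsionProduct p) (s n).2 :
      t - (s n).1 ∈ torsionProduct p)
    refine ⟨⟨y, r' + n, ?_⟩, Subtype.ext hy'⟩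
    rw [pow_add, mul_smul, ← hy', hr']

variable (p) in
/-- The generator of the `j`-th factor of `torsionProduct p`. -/
noncomputable def torsionProduct.single (j : ℕ) : torsionProduct.{u} p := by
  classical
  exact ⟨Pi.single ⟨j⟩ 1, j, by
    rw [← Pi.single_smul, zmod_pow_nsmul_eq_zero, Pi.single_zero]⟩

/-- Elements `z j` of a torsion-complete group with `p ^ j • z j = 0` define a homomorphism from
the torsion subgroup of `∏ j, ℤ/p^j`, whose values are limits of the expected sums. -/
lemma IsTorsionComplete.exists_hom (hT : IsTorsionComplete p T) (hp : p.Prime) (z : ℕ → T)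
    (hz : ∀ j, p ^ j • z j = 0) :
    ∃ φ : torsionProduct.{u} p →+ T, (∀ j, φ (torsionProduct.single p j) = z j) ∧
      ∀ (a : torsionProduct.{u} p) (n : ℕ), ∃ (J : ℕ) (c : ℕ → ℤ) (y : T),
        φ a = ∑ j ∈ Finset.range J, c j • z j + p ^ n • y ∧
        ∀ r : ℕ, p ^ r • a = 0 → p ^ (r + n) • y = 0 := by
  classical
  let f : ∀ j, ZMod (p ^ j) →+ T := fun j =>
    ZMod.lift _ ⟨zmultiplesHom T (z j), by rw [zmultiplesHom_apply, natCast_zsmul, hz]⟩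
  have hfint : ∀ j (a : ℤ), f j a = a • z j := fun j a => by
    simp [f, -ZMod.intCast_cast]
  have hf : ∀ j x, f j x = (x.cast : ℤ) • z j := fun j x => by
    conv_lhs => rw [← ZMod.intCast_zmod_cast x]
    exact hfint _ _
  let P : ℕ → torsionProduct.{u} p →+ T := fun J =>
    ∑ j ∈ Finset.range J, (f j).comp ((Pi.evalAddMonoidHom _ ⟨j⟩).comp (torsionProduct p).subtype)
  have hP : ∀ J a, P J a = ∑ j ∈ Finset.range J, f j (a.1 ⟨j⟩) := fun J a => by
    simp [P, AddMonoidHom.finsetSum_apply]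
  -- Convergence is stated without the exponent of `a`, so that uniqueness of limits makes the map
  -- additive.
  let C : torsionProduct.{u} p → T → Prop := fun a t =>
    ∀ n, ∃ J₀, ∀ J, J₀ ≤ J → ∃ y, t - P J a = p ^ n • y
  have hCunique : ∀ a t t', C a t → C a t' → t = t' := by
    intro a t t' h h'
    rw [← sub_eq_zero]
    refine hT.eq_zero fun n => ?_
    obtain ⟨J, hJ⟩ := h n
    obtain ⟨J', hJ'⟩ := h' n
    obtain ⟨y, hy⟩ := hJ _ (le_max_left J J')
    obtain ⟨y', hy'⟩ := hJ' _ (le_max_right J J')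
    exact ⟨y - y', by rw [smul_sub, ← hy, ← hy']; abel⟩
  have hCadd : ∀ a a' t t', C a t → C a' t' → C (a + a') (t + t') := by
    intro a a' t t' h h' n
    obtain ⟨J, hJ⟩ := h n
    obtain ⟨J', hJ'⟩ := h' n
    refine ⟨max J J', fun K hK => ?_⟩
    obtain ⟨y, hy⟩ := hJ K (le_trans (le_max_left _ _) hK)
    obtain ⟨y', hy'⟩ := hJ' K (le_trans (le_max_right _ _) hK)
    exact ⟨y + y', by rw [smul_add, ← hy, ← hy', map_add]; abel⟩
  -- When `p ^ r` kills `a`, its `j`-th coordinate is divisible by `p ^ (j - r)`; hence the shift by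
  -- `r`.
  have hstep : ∀ (a : torsionProduct.{u} p) (r n J : ℕ), p ^ r • a = 0 → n + r ≤ J →
      ∃ y, P J a - P (n + r) a = p ^ n • y := by
    intro a r n J ha hJ
    rw [hP, hP, ← Finset.sum_range_add_sum_Ico _ hJ, add_sub_cancel_left]
    have : ∑ j ∈ Finset.Ico (n + r) J, f j (a.1 ⟨j⟩) ∈
        (nsmulAddMonoidHom (α := T) (p ^ n)).range := by
      refine sum_mem fun j hj => ?_
      have hj' := (Finset.mem_Ico.1 hj).1
      have haj : p ^ r • a.1 ⟨j⟩ = 0 := congrFun (congrArg Subtype.val ha) ⟨j⟩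
      obtain ⟨e, he⟩ := zmod_exists_eq_pow_nsmul hp (show r ≤ j by omega) haj
      refine ⟨p ^ (j - r - n) • e • z j, ?_⟩
      rw [he, ← Int.cast_mul, hfint, mul_smul, natCast_zsmul, nsmulAddMonoidHom_apply,
        ← mul_smul, ← pow_add]
      congr 2
      omega
    obtain ⟨y, hy⟩ := this
    exact ⟨y, hy.symm⟩
  have hCex : ∀ a, ∃ t, C a t := by
    intro a
    obtain ⟨r, hr⟩ := torsionProduct_isPrimary a
    obtain ⟨t, ht⟩ := hT.exists_limit hp (s := fun n => P (n + r) a) (r := r)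
      (fun n => hstep a r n _ hr (by omega)) (fun n => by rw [← map_nsmul, hr, map_zero])
    refine ⟨t, fun n => ⟨n + r, fun J hJ => ?_⟩⟩
    obtain ⟨y, hy⟩ := ht n
    obtain ⟨y', hy'⟩ := hstep a r n J hr hJ
    exact ⟨y - y', by rw [smul_sub, ← hy, ← hy']; abel⟩
  choose φ hφ using hCex
  let Φ : torsionProduct.{u} p →+ T := AddMonoidHom.mk' φ fun a a' =>
    hCunique _ _ _ (hφ _) (hCadd _ _ _ _ (hφ a) (hφ a'))
  refine ⟨Φ, fun j => ?_, fun a n => ?_⟩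
  · refine hCunique _ _ _ (hφ _) fun n => ⟨j + 1, fun J hJ => ⟨0, ?_⟩⟩
    rw [hP, Finset.sum_eq_single j]
    · have h1 : (torsionProduct.single p j).1 ⟨j⟩ = ((1 : ℤ) : ZMod (p ^ j)) := by
        simp [torsionProduct.single]
      rw [h1, hfint, one_smul, sub_self, smul_zero]
    · intro i _ hij
      have h1 : (torsionProduct.single.{u} p j).1 ⟨i⟩ = 0 := by
        simp only [torsionProduct.single]
        exact Pi.single_eq_of_ne (fun h => hij (congrArg ULift.down h)) _
      rw [h1, map_zero]
    · intro hj
      exact absurd (Finset.mem_range.2 (by omega)) hj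
  · obtain ⟨J, hJ⟩ := hφ a n
    obtain ⟨y, hy⟩ := hJ J le_rfl
    refine ⟨J, fun j => ((a.1 ⟨j⟩).cast : ℤ), y, ?_, fun r hr => ?_⟩
    · rw [← hy, hP, Finset.sum_congr rfl fun j _ => hf j (a.1 ⟨j⟩)]
      change φ a = _
      abel
    · have h1 : p ^ r • (Φ a - P J a) = 0 := by
        rw [← AddMonoidHom.sub_apply, ← map_nsmul, hr, map_zero]
      rw [pow_add, mul_smul, ← hy]
      exact h1

end TorsionComplete

/-! ### Transfer of thinness between the group and a large subgroup. -/

section Thin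

variable {p : ℕ} {G : Type u} [AddCommGroup G]

lemma IsThin.addSubgroup (hG : IsThin p G) (L : AddSubgroup G) : IsThin p L := by
  intro T _ hT f
  obtain ⟨K, hK, hKf⟩ := hG T hT (L.subtype.comp f)
  exact ⟨K, hK, fun x hx => Subtype.ext (hKf hx)⟩

lemma IsThin.of_containsHighTorsion (hp : p.Prime) {L : AddSubgroup G}
    (hL : ContainsHighTorsion p L) (hthin : IsThin p L) : IsThin p G := by
  intro T _ hT f
  refine isSmall_of_containsHighTorsion_ker hp hT.primary f ?_
  intro k
  by_contra! hcon
  choose N hN using hL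
  choose y hy hfy using fun j => hcon (N j + j)
  -- `y j` has exponent `N j + j + k`: the factor `p ^ (N j + k)` leaves `p ^ j`-torsion, and `f (z
  -- j)` lies in `p ^ N j G`.
  let z : ℕ → T := fun j => p ^ (N j + k) • y j
  have hz : ∀ j, p ^ j • z j = 0 := fun j => by
    rw [← hy j, ← mul_smul, ← pow_add]
    congr 2
    omega
  have hfz : ∀ j, f (z j) ∈ L := fun j => by
    have h1 : f (z j) = p ^ N j • f (p ^ k • y j) := by
      rw [← map_nsmul, ← mul_smul, ← pow_add]
    rw [h1]
    apply hN
    rw [← map_nsmul, ← mul_smul, ← pow_add, hy, map_zero]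
  obtain ⟨φ, hφz, hφ⟩ := hT.exists_hom hp z hz
  have hfφ : ∀ a, (f.comp φ) a ∈ L := by
    intro a
    obtain ⟨r, hr⟩ := torsionProduct_isPrimary a
    -- Precision `N r` matches the exponent `r` of `a`, so `f` sends the remainder into `L`.
    obtain ⟨J, c, x, hx, hx0⟩ := hφ a (N r)
    rw [AddMonoidHom.comp_apply, hx, map_add, map_sum, map_nsmul]
    refine add_mem (sum_mem fun j _ => ?_) (hN r _ ?_)
    · rw [map_zsmul]
      exact zsmul_mem (hfz j) _
    · rw [← map_nsmul, add_comm, hx0 r hr, map_zero]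
  obtain ⟨K, hK, hKf⟩ := hthin _ (isTorsionComplete_torsionProduct hp)
    ((f.comp φ).codRestrict L hfφ)
  -- With `j = n + k`, `p ^ n • z j` is exactly `p ^ (N j + j) • y j`, which `f` does not kill.
  obtain ⟨n, hn⟩ := hK.containsHighTorsion hp torsionProduct_isPrimary k
  have hmem := hKf (hn (torsionProduct.single p (n + k)) (Subtype.ext (by
    simp only [torsionProduct.single, AddSubgroup.coe_nsmul, ZeroMemClass.coe_zero]
    rw [← Pi.single_smul, zmod_pow_nsmul_eq_zero, Pi.single_zero])))
  have h1 : f (φ (p ^ n • torsionProduct.single p (n + k))) = 0 := congrArg Subtype.val hmem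
  rw [map_nsmul, hφz, ← mul_smul, ← pow_add] at h1
  refine hfy (n + k) ?_
  rw [AddMonoidHom.mem_ker, ← h1]
  congr 3
  omega

end Thin

end ThinGroup

theorem theorem3 {p : ℕ} (hp : p.Prime) {G : Type*} [AddCommGroup G]
    (hG : ThinGroup.IsPrimary p G) (L : AddSubgroup G) (hL : ThinGroup.IsLarge L) :
    ThinGroup.IsThin p G ↔ ThinGroup.IsThin p L :=
  ⟨fun h => h.addSubgroup L, fun h => h.of_containsHighTorsion hp (hL.containsHighTorsion hp hG)⟩
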